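/- Let $X$ be a standard Borel space and let $\mathcal R$ be a Borel equivalence relation on $X$ all of whose classes are countable. A *treeing* of $\mathcal R$ is a Borel set $G \subseteq X\times X$ that is symmetric, disjoint from the diagonal and contained in $\mathcal R$, and such that for every $\mathcal R$-class $C$ the graph with vertex set $C$ and edge set $G\cap (C\times C)$ is a tree (connected and without cycles); $\mathcal R$ is *treeable* if it admits a treeing. Suppose that $\mathcal R$ is treeable. Then every Borel equivalence relation $\mathcal S$ on $X$ with $\mathcal S\subseteq\mathcal R$ is treeable. More generally, if $A\subseteq X$ is a Borel subset and $\mathcal S$ is a Borel equivalence relation on $A$ with $\mathcal S\subseteq\mathcal R$, then $\mathcal S$ is treeable (as an equivalence relation on the standard Borel space $A$). -/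

import Mathlib

/-- The equivalence relation `R` is Borel: its graph is a measurable subset of `X × X`. -/
def IsBorelRel {X : Type*} [MeasurableSpace X] (R : Setoid X) : Prop :=
  MeasurableSet {p : X × X | R p.1 p.2}

/-- `R` is a countable Borel equivalence relation: it is Borel and its classes are countable. -/
structure IsCountableBorelRel {X : Type*} [MeasurableSpace X] (R : Setoid X) : Prop where
  borel : IsBorelRel R
  countable_class : ∀ x : X, {y : X | R x y}.Countable

/-- `G` is a treeing of `R`: a Borel graph on `X` (symmetric and disjoint from the diagonal)
that is contained in `R` and whose restriction to each `R`-class is a tree, in particular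
connected. -/
structure IsTreeing {X : Type*} [MeasurableSpace X] (R : Setoid X) (G : SimpleGraph X) :
    Prop where
  borel : MeasurableSet {p : X × X | G.Adj p.1 p.2}
  adj_rel : ∀ x y : X, G.Adj x y → R x y
  isTree : ∀ x : X, (G.induce {y : X | R x y}).IsTree

/-- `R` is treeable: it admits a treeing. -/
def IsTreeable {X : Type*} [MeasurableSpace X] (R : Setoid X) : Prop :=
  ∃ G : SimpleGraph X, IsTreeing R G

/-! Fix a treeing `G` of `R` and an injection `i` carrying `S` into `R` (the identity, or the
inclusion of `A`). The image of an `S`-class `C` lies in one tree of `G`. Every vertex of that tree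
walks towards `C`, each step going to a neighbor strictly closer to `C`, until it hits `C`. This
retracts the tree onto `C`. The endpoint is constant along each walk, so the fibers of the
retraction are connected, and contracting them yields a tree with vertex set `C`
(`SimpleGraph.IsTree.of_contraction`).

The contracted graph must also be Borel. By Lusin–Novikov, `R` is enumerated by Borel maps `g n`
(`IsCountableBorelRel.exists_measurable_enumeration`). They turn quantifiers over neighbors into
countable unions, and taking the first suitable index makes the choice of each step Borel.

Lusin–Novikov reduces to a continuous map with countable fibers. If its domain were not a countable
union of Borel sets of injectivity, a Cantor-like scheme would produce a nonempty perfect set inside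
one fiber. -/

open Set MeasureTheory Topology Filter

/-! ### Lusin–Novikov uniformization -/

section LusinNovikov

/-- `W` is a countable union of measurable sets on each of which `f` is injective. -/
def IsSigmaInjective {Z X : Type*} [MeasurableSpace Z] (f : Z → X) (W : Set Z) : Prop :=
  ∃ B : ℕ → Set Z, (∀ n, MeasurableSet (B n) ∧ InjOn f (B n)) ∧ W = ⋃ n, B n

/-- The sequences whose first `k + 1` terms lie in a common fiber of `f`, the `j`-th one in
`U j ∩ Y`. -/
def fiberTuples {Z X : Type*} (f : Z → X) (k : ℕ) (U : ℕ → Set Z) (Y : Set Z) : Set (ℕ → Z) :=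
  {z | ∀ j ≤ k, z j ∈ U j ∧ z j ∈ Y ∧ f (z j) = f (z 0)}

/-- The tuple `U 0, …, U k` meets no fiber of `f` outside of a suitable set which is a countable
union of measurable sets of injectivity of `f`. -/
def IsNegligibleTuple {Z X : Type*} [MeasurableSpace Z] (f : Z → X) (k : ℕ) (U : ℕ → Set Z) :
    Prop :=
  ∃ W, IsSigmaInjective f W ∧ fiberTuples f k U Wᶜ = ∅

section Measurable

variable {Z X : Type*} [MeasurableSpace Z] {f : Z → X}

theorem IsSigmaInjective.measurableSet {W : Set Z} (h : IsSigmaInjective f W) :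
    MeasurableSet W := by
  obtain ⟨B, hB, rfl⟩ := h
  exact MeasurableSet.iUnion fun n => (hB n).1

theorem isSigmaInjective_of_injOn {W : Set Z} (hW : MeasurableSet W) (h : InjOn f W) :
    IsSigmaInjective f W :=
  ⟨fun _ => W, fun _ => ⟨hW, h⟩, (iUnion_const W).symm⟩

theorem IsSigmaInjective.iUnion {ι : Type*} [Countable ι] {W : ι → Set Z}
    (h : ∀ i, IsSigmaInjective f (W i)) : IsSigmaInjective f (⋃ i, W i) := by
  rcases isEmpty_or_nonempty ι with hι | hι
  · rw [iUnion_of_empty]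
    exact isSigmaInjective_of_injOn MeasurableSet.empty (injOn_empty f)
  choose B hB hW using h
  obtain ⟨e, he⟩ := exists_surjective_nat (ι × ℕ)
  refine ⟨fun n => B (e n).1 (e n).2, fun n => hB _ _, ?_⟩
  rw [he.iUnion_comp (fun p : ι × ℕ => B p.1 p.2), iUnion_prod']
  exact iUnion_congr hW

theorem IsSigmaInjective.union {V W : Set Z} (hV : IsSigmaInjective f V)
    (hW : IsSigmaInjective f W) : IsSigmaInjective f (V ∪ W) := by
  rw [union_eq_iUnion]
  exact IsSigmaInjective.iUnion fun b => by cases b <;> assumption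

theorem fiberTuples_mono {Z X : Type*} {f : Z → X} {k : ℕ} {U : ℕ → Set Z}
    {Y Y' : Set Z} (h : Y ⊆ Y') :
    fiberTuples f k U Y ⊆ fiberTuples f k U Y' :=
  fun _ hz j hj => ⟨(hz j hj).1, h (hz j hj).2.1, (hz j hj).2.2⟩

theorem measurableSet_fiberTuples [MeasurableSpace X] [MeasurableEq X] (hf : Measurable f)
    (k : ℕ) {U : ℕ → Set Z} (hU : ∀ j, MeasurableSet (U j)) {Y : Set Z} (hY : MeasurableSet Y) :
    MeasurableSet (fiberTuples f k U Y) := by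
  have : fiberTuples f k U Y = ⋂ j, ⋂ _ : j ≤ k,
      ((fun z : ℕ → Z => z j) ⁻¹' (U j) ∩ ((fun z : ℕ → Z => z j) ⁻¹' Y ∩
        {z | f (z j) = f (z 0)})) := by
    ext z; simp [fiberTuples]
  rw [this]
  refine MeasurableSet.iInter fun j => MeasurableSet.iInter fun _ => ?_
  exact (measurable_pi_apply j (hU j)).inter ((measurable_pi_apply j hY).inter
    (measurableSet_eq_fun (hf.comp (measurable_pi_apply j)) (hf.comp (measurable_pi_apply 0))))

/-- The points sharing their fiber of `f` with a different point of a given measurable image form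
an analytic set. -/
theorem analyticSet_fiber_neighbors [TopologicalSpace Z] [PolishSpace Z] [BorelSpace Z]
    [MeasurableSpace X] [MeasurableEq X] (hf : Measurable f) {V : Type*} [MeasurableSpace V]
    [StandardBorelSpace V] {φ : V → Z} (hφ : Measurable φ) {H : Set V} (hH : MeasurableSet H) :
    AnalyticSet {z | ∃ v ∈ H, f (φ v) = f z ∧ φ v ≠ z} := by
  have h : MeasurableSet {p : V × Z | p.1 ∈ H ∧ f (φ p.1) = f p.2 ∧ φ p.1 ≠ p.2} :=
    (measurable_fst hH).inter ((measurableSet_eq_fun (hf.comp (hφ.comp measurable_fst))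
      (hf.comp measurable_snd)).inter
      (measurableSet_eq_fun (hφ.comp measurable_fst) measurable_snd).compl)
  have himage := h.analyticSet_image measurable_snd
  convert himage using 1
  ext z
  simp

/-- A measurable image on which `f` is injective is contained in a measurable set on which `f` is
injective. -/
theorem exists_measurableSet_injOn_superset [StandardBorelSpace Z] [MeasurableSpace X]
    [MeasurableEq X] (hf : Measurable f) {V : Type*} [MeasurableSpace V] [StandardBorelSpace V]
    {φ : V → Z} (hφ : Measurable φ) {H : Set V} (hH : MeasurableSet H)
    (hinj : InjOn f (φ '' H)) :
    ∃ B, MeasurableSet B ∧ φ '' H ⊆ B ∧ InjOn f B := by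
  let := upgradeStandardBorel Z
  -- One separation only ensures that no point of `B` shares a fiber with a different point of the
  -- image. Hence no image point has a different fiber mate in `B`, which permits a second
  -- separation, now excluding fiber mates of points of `B`.
  obtain ⟨B, hAB, hNB, hB⟩ := (hH.analyticSet_image hφ).measurablySeparable
    (analyticSet_fiber_neighbors hf hφ hH) (by
      rw [Set.disjoint_left]
      rintro _ ⟨v, hv, rfl⟩ ⟨w, hw, hfw, hne⟩
      exact hne (hinj (mem_image_of_mem φ hw) (mem_image_of_mem φ hv) hfw))
  obtain ⟨B', hAB', hNB', hB'⟩ := (hH.analyticSet_image hφ).measurablySeparable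
    (analyticSet_fiber_neighbors hf measurable_id hB) (by
      rw [Set.disjoint_left]
      rintro _ ⟨v, hv, rfl⟩ ⟨b, hb, hfb, hne⟩
      exact Set.disjoint_left.1 hNB ⟨v, hv, hfb.symm, fun h => hne h.symm⟩ hb)
  refine ⟨B ∩ B', hB.inter hB', subset_inter hAB hAB', ?_⟩
  intro x hx y hy hxy
  by_contra hne
  exact Set.disjoint_left.1 hNB' ⟨x, hx.1, hxy, hne⟩ hy.2

end Measurable

/-! ### The perfect set scheme for continuous maps -/

section Metric

variable {Z X : Type*} [MetricSpace Z] [SecondCountableTopology Z] [CompleteSpace Z]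
  [MeasurableSpace Z] [BorelSpace Z] {f : Z → X}

theorem exists_mem_countableBasis_closure_subset {Z : Type*} [MetricSpace Z]
    [SecondCountableTopology Z] {z : Z} {O : Set Z} (hO : IsOpen O) (hz : z ∈ O) {ε : ℝ}
    (hε : 0 < ε) :
    ∃ V ∈ TopologicalSpace.countableBasis Z, z ∈ V ∧ closure V ⊆ O ∧
      ∀ x ∈ V, ∀ y ∈ V, dist x y ≤ ε := by
  obtain ⟨r, hr, hrO⟩ := Metric.nhds_basis_closedBall.mem_iff.1 (hO.mem_nhds hz)
  have hpos : 0 < min r (ε / 2) := lt_min hr (half_pos hε)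
  obtain ⟨V, hV, hzV, hVs⟩ := (TopologicalSpace.isBasis_countableBasis Z).exists_subset_of_mem_open
    (Metric.mem_ball_self (x := z) hpos) Metric.isOpen_ball
  refine ⟨V, hV, hzV, ?_, fun x hx y hy => ?_⟩
  · refine (closure_mono hVs).trans (Metric.closure_ball_subset_closedBall.trans ?_)
    exact (Metric.closedBall_subset_closedBall (min_le_left _ _)).trans hrO
  · have hx' := Metric.mem_ball.1 (hVs hx)
    have hy' := Metric.mem_ball.1 (hVs hy)
    have := min_le_right r (ε / 2)
    have := dist_triangle_right x y z
    linarith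

/-- `V 0, …, V (k + 1)` refines `U 0, …, U k` by splitting `U i` into `V i` and `V (k + 1)`. -/
structure IsSplitting {Z : Type*} [MetricSpace Z] (k i : ℕ) (ε : ℝ) (U V : ℕ → Set Z) :
    Prop where
  closure_subset : ∀ j ≤ k, closure (V j) ⊆ U j
  closure_last_subset : closure (V (k + 1)) ⊆ U i
  disjoint : Disjoint (V i) (V (k + 1))
  dist_le : ∀ j ≤ k + 1, ∀ x ∈ V j, ∀ y ∈ V j, dist x y ≤ ε

/-- If all fine splittings by basic open sets were negligible, countably many witnesses could be
removed at once. On what remains, the `i`-th coordinates of fiber tuples would form a set of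
injectivity, and enlarging it to a Borel one would make `U` negligible. -/
theorem exists_isSplitting [MeasurableSpace X] [MeasurableEq X] (hf : Measurable f) {k i : ℕ}
    (hi : i ≤ k) {U : ℕ → Set Z} (hU : ∀ j, IsOpen (U j)) (hbig : ¬ IsNegligibleTuple f k U)
    {ε : ℝ} (hε : 0 < ε) :
    ∃ V : ℕ → Set Z, (∀ j, IsOpen (V j)) ∧ ¬ IsNegligibleTuple f (k + 1) V ∧
      IsSplitting k i ε U V := by
  by_contra! hcon
  let b := TopologicalSpace.countableBasis Z
  have : Countable b := (TopologicalSpace.countable_countableBasis Z).to_subtype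
  -- Only the first `k + 2` sets matter, so countably many families suffice; the value `∅` beyond
  -- them plays no role.
  let fam : (Fin (k + 2) → b) → ℕ → Set Z :=
    fun c j => if h : j < k + 2 then (c ⟨j, h⟩ : Set Z) else ∅
  have hfam : ∀ c j, IsOpen (fam c j) := by
    intro c j
    by_cases h : j < k + 2
    · simpa [fam, h] using TopologicalSpace.isOpen_of_mem_countableBasis (c ⟨j, h⟩).2
    · simp [fam, h]
  have hsmall : ∀ c, ∃ W, IsSigmaInjective f W ∧
      (IsSplitting k i ε U (fam c) → fiberTuples f (k + 1) (fam c) Wᶜ = ∅) := by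
    intro c
    by_cases hc : IsSplitting k i ε U (fam c)
    · by_cases hn : IsNegligibleTuple f (k + 1) (fam c)
      · obtain ⟨W, hW, h⟩ := hn
        exact ⟨W, hW, fun _ => h⟩
      · exact absurd hc (hcon _ (hfam c) hn)
    · exact ⟨∅, isSigmaInjective_of_injOn MeasurableSet.empty (injOn_empty f), fun h => absurd h hc⟩
  choose W hW hWc using hsmall
  have hWU := IsSigmaInjective.iUnion hW
  set Y := (⋃ c, W c)ᶜ with hY
  have hYm : MeasurableSet Y := hWU.measurableSet.compl
  -- Two distinct `i`-th coordinates in one fiber have disjoint neighborhoods. Appending the second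
  -- one to the first tuple gives a tuple in a splitting that should be negligible.
  have hinj : InjOn f ((fun z : ℕ → Z => z i) '' fiberTuples f k U Y) := by
    rintro _ ⟨z, hz, rfl⟩ _ ⟨z', hz', rfl⟩ hzz
    by_contra hne
    obtain ⟨O, O', hO, hO', hzO, hzO', hOO⟩ := t2_separation hne
    let w : ℕ → Z := fun j => if j = k + 1 then z' i else z j
    let N : ℕ → Set Z := fun j => if j = k + 1 then U i ∩ O' else if j = i then U j ∩ O else U j
    have hN : ∀ j, IsOpen (N j) := by
      intro j
      simp only [N]
      split_ifs
      · exact (hU i).inter hO'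
      · exact (hU j).inter hO
      · exact hU j
    have hwN : ∀ j ≤ k + 1, w j ∈ N j := by
      intro j hj
      by_cases h1 : j = k + 1
      · simp only [w, N, h1, if_true]
        exact ⟨(hz' i hi).1, hzO'⟩
      · have hjk : j ≤ k := by omega
        by_cases h2 : j = i
        · subst h2
          simp only [w, N, h1, if_true, if_false]
          exact ⟨(hz j hjk).1, hzO⟩
        · simp only [w, N, h1, h2, if_false]
          exact (hz j hjk).1
    have hV : ∀ j : Fin (k + 2), ∃ V : b, w j ∈ (V : Set Z) ∧ closure (V : Set Z) ⊆ N j ∧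
        ∀ x ∈ (V : Set Z), ∀ y ∈ (V : Set Z), dist x y ≤ ε := by
      intro j
      obtain ⟨V, hV, h⟩ := exists_mem_countableBasis_closure_subset (hN j)
        (hwN j (by omega)) hε
      exact ⟨⟨V, hV⟩, h⟩
    choose c hwc hcN hcε using hV
    have hfam' : ∀ j (h : j < k + 2), fam c j = c ⟨j, h⟩ := fun j h => by simp [fam, h]
    have hNU : ∀ j ≤ k, N j ⊆ U j := by
      intro j hj
      have h1 : j ≠ k + 1 := by omega
      simp only [N, h1, if_false]
      split_ifs
      · exact inter_subset_left
      · exact subset_rfl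
    have hik : i ≠ k + 1 := by omega
    have hsplit : IsSplitting k i ε U (fam c) := by
      refine ⟨fun j hj => ?_, ?_, ?_, fun j hj => ?_⟩
      · rw [hfam' j (by omega)]
        exact (hcN ⟨j, by omega⟩).trans (hNU j hj)
      · rw [hfam' (k + 1) (by omega)]
        refine (hcN ⟨k + 1, by omega⟩).trans ?_
        simp [N]
      · rw [hfam' (k + 1) (by omega), hfam' i (by omega)]
        refine hOO.mono (subset_closure.trans ((hcN _).trans ?_))
          (subset_closure.trans ((hcN _).trans ?_))
        · simp [N, hik]
        · simp [N]
      · rw [hfam' j (by omega)]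
        exact hcε _
    have hw : w ∈ fiberTuples f (k + 1) (fam c) (W c)ᶜ := by
      have hYc : Y ⊆ (W c)ᶜ := compl_subset_compl.2 (subset_iUnion W c)
      have hw0 : w 0 = z 0 := by simp [w]
      intro j hj
      refine ⟨by rw [hfam' j (by omega)]; exact hwc ⟨j, by omega⟩, ?_, ?_⟩
      · by_cases h1 : j = k + 1
        · simpa only [w, h1, if_true] using hYc (hz' i hi).2.1
        · simpa only [w, h1, if_false] using hYc (hz j (by omega)).2.1
      · rw [hw0]
        by_cases h1 : j = k + 1
        · simp only [w, h1, if_true]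
          exact hzz.symm.trans (hz i hi).2.2
        · simp only [w, h1, if_false]
          exact (hz j (by omega)).2.2
    rw [hWc c hsplit] at hw
    exact hw
  obtain ⟨B, hB, hAB, hBinj⟩ := exists_measurableSet_injOn_superset hf (measurable_pi_apply i)
    (measurableSet_fiberTuples hf k (fun j => (hU j).measurableSet) hYm) hinj
  refine hbig ⟨(⋃ c, W c) ∪ B, hWU.union (isSigmaInjective_of_injOn hB hBinj), ?_⟩
  rw [eq_empty_iff_forall_notMem]
  intro z hz
  rw [compl_union] at hz
  exact (hz i hi).2.1.2 (hAB (mem_image_of_mem _ (fiberTuples_mono inter_subset_left hz)))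

/-- Iterated splitting gives shrinking open sets whose limit points `z j` all lie in one fiber, by
continuity. Each index is split infinitely often, so no `z j` is isolated among them, and the
closure of their range is a perfect subset of that fiber. -/
theorem isSigmaInjective_univ_of_continuous [TopologicalSpace X] [T2Space X] [MeasurableSpace X]
    [BorelSpace X] [MeasurableEq X] (hf : Continuous f)
    (hcount : ∀ x, (f ⁻¹' {x}).Countable) : IsSigmaInjective f univ := by
  by_contra hbig
  let State : ℕ → Type _ := fun k =>
    {U : ℕ → Set Z // (∀ j, IsOpen (U j)) ∧ ¬ IsNegligibleTuple f k U}
  -- The index `k.unpair.1` is at most `k` and takes every value infinitely often.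
  have hstep : ∀ k (U : State k), ∃ V : State (k + 1),
      IsSplitting k k.unpair.1 ((1 / 2 : ℝ) ^ (k + 1)) U.1 V.1 := fun k U => by
    obtain ⟨V, hVo, hVb, hV⟩ := exists_isSplitting hf.measurable (Nat.unpair_left_le k) U.2.1 U.2.2
      (show (0 : ℝ) < (1 / 2) ^ (k + 1) by positivity)
    exact ⟨⟨V, hVo, hVb⟩, hV⟩
  choose step hstep using hstep
  have hstart : ¬ IsNegligibleTuple f 0 fun _ => univ := by
    rintro ⟨W, hW, hW'⟩
    refine hbig ?_
    convert hW
    refine (eq_univ_of_forall fun z => ?_).symm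
    by_contra hz
    have : (fun _ => z) ∈ fiberTuples f 0 (fun _ => univ) Wᶜ := fun j _ => ⟨trivial, hz, rfl⟩
    rw [hW'] at this
    exact this
  let seq : ∀ k, State k := fun k =>
    Nat.rec (motive := State) ⟨fun _ => univ, fun _ => isOpen_univ, hstart⟩ step k
  let U : ℕ → ℕ → Set Z := fun k => (seq k).1
  have hU : ∀ k, IsSplitting k k.unpair.1 ((1 / 2 : ℝ) ^ (k + 1)) (U k) (U (k + 1)) :=
    fun k => hstep k (seq k)
  have hne : ∀ k, ∃ w, w ∈ fiberTuples f k (U k) univ := by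
    intro k
    by_contra! h
    refine (seq k).2.2 ⟨∅, isSigmaInjective_of_injOn MeasurableSet.empty (injOn_empty f), ?_⟩
    rw [compl_empty]
    exact eq_empty_iff_forall_notMem.2 h
  choose w hw using hne
  have hanti : ∀ j k l, j ≤ k → k ≤ l → U l j ⊆ U k j := by
    intro j k l hjk hkl
    induction l, hkl using Nat.le_induction with
    | base => exact subset_rfl
    | succ l hkl ih =>
      exact (subset_closure.trans ((hU l).closure_subset j (by omega))).trans ih
  have hdist : ∀ j k, j ≤ k → 1 ≤ k → ∀ x ∈ U k j, ∀ y ∈ U k j, dist x y ≤ (1 / 2 : ℝ) ^ k := by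
    intro j k hjk hk
    obtain ⟨k, rfl⟩ : ∃ m, k = m + 1 := ⟨k - 1, by omega⟩
    exact (hU k).dist_le j hjk
  have hlim : ∀ j, ∃ z, Tendsto (fun k => w k j) atTop (𝓝 z) := by
    intro j
    refine cauchySeq_tendsto_of_complete (Metric.cauchySeq_iff.2 fun ε hε => ?_)
    obtain ⟨n, hn⟩ := exists_pow_lt_of_lt_one hε (show (1 / 2 : ℝ) < 1 by norm_num)
    refine ⟨max n (max j 1), fun k hk l hl => ?_⟩
    have h1 : j ≤ max n (max j 1) := by omega
    refine (hdist j _ h1 (by omega) _ (hanti j _ k h1 hk (hw k j (by omega)).1)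
      _ (hanti j _ l h1 hl (hw l j (by omega)).1)).trans_lt (lt_of_le_of_lt ?_ hn)
    exact pow_le_pow_of_le_one (by norm_num) (by norm_num) (le_max_left _ _)
  choose z hz using hlim
  have hzU : ∀ j k, j ≤ k → z j ∈ U k j := by
    intro j k hjk
    refine (hU k).closure_subset j hjk (mem_closure_of_tendsto (hz j) ?_)
    filter_upwards [eventually_ge_atTop (k + 1)] with l hl
    exact hanti j _ l (by omega) hl (hw l j (by omega)).1
  have hzf : ∀ j, f (z j) = f (z 0) := by
    intro j
    refine tendsto_nhds_unique ((hf.tendsto _).comp (hz j))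
      (((hf.tendsto _).comp (hz 0)).congr' ?_)
    filter_upwards [eventually_ge_atTop j] with k hk
    exact (hw k j hk).2.2.symm
  have hpre : Preperfect (range z) := by
    rw [preperfect_iff_nhds]
    rintro _ ⟨i, rfl⟩ O hO
    obtain ⟨ε, hε, hεO⟩ := Metric.mem_nhds_iff.1 hO
    obtain ⟨n, hn⟩ := exists_pow_lt_of_lt_one hε (show (1 / 2 : ℝ) < 1 by norm_num)
    -- At this stage the set around `z i` is split and is already small, so the new point `z (k +
    -- 1)` is close to `z i`; disjointness of the two halves keeps them apart.
    let k := Nat.pair i (n + 1)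
    have hki : k.unpair.1 = i := by simp [k]
    have hkn : n + 1 ≤ k := Nat.right_le_pair _ _
    have hik : i ≤ k := Nat.left_le_pair _ _
    have h := hU k
    rw [hki] at h
    have hlast : z (k + 1) ∈ U (k + 1) (k + 1) := hzU (k + 1) (k + 1) le_rfl
    refine ⟨z (k + 1), ⟨hεO ?_, mem_range_self _⟩, fun he => ?_⟩
    · refine Metric.mem_ball.2 ((hdist i k hik (by omega) _
        (h.closure_last_subset (subset_closure hlast)) _ (hzU i k hik)).trans_lt ?_)
      exact lt_of_le_of_lt (pow_le_pow_of_le_one (by norm_num) (by norm_num) (by omega)) hn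
    · exact Set.disjoint_left.1 h.disjoint (hzU i (k + 1) (by omega)) (he ▸ hlast)
  obtain ⟨g, hg, -, hginj⟩ := hpre.perfect_closure.exists_nat_bool_injection
    ((range_nonempty z).closure)
  have hsub : closure (range z) ⊆ f ⁻¹' {f (z 0)} :=
    closure_minimal (by rintro _ ⟨j, rfl⟩; exact hzf j) (isClosed_singleton.preimage hf)
  have hgc : (range g).Countable := (hcount (f (z 0))).mono (hg.trans hsub)
  have : Countable (ℕ → Bool) := by
    have := hgc.to_subtype
    exact (Equiv.ofInjective g hginj).injective.countable
  obtain ⟨e, he⟩ := exists_surjective_nat (ℕ → Bool)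
  obtain ⟨n, hn⟩ := he fun n => !e n n
  simpa using congrFun hn n

end Metric

/-- A countable-to-one measurable map between standard Borel spaces is injective on each piece of
some countable measurable cover. -/
theorem isSigmaInjective_univ_of_measurable {Z X : Type*} [MeasurableSpace Z]
    [StandardBorelSpace Z] [MeasurableSpace X] [StandardBorelSpace X] {f : Z → X}
    (hf : Measurable f) (hcount : ∀ x, (f ⁻¹' {x}).Countable) : IsSigmaInjective f univ := by
  let := upgradeStandardBorel X
  let := upgradeStandardBorel Z
  have hpZ : PolishSpace Z := inferInstance
  have hbZ : ‹MeasurableSpace Z› = borel Z := BorelSpace.measurable_eq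
  -- A finer Polish topology makes `f` continuous without changing the Borel sets.
  obtain ⟨t, ht, hft, htp⟩ := hf.exists_continuous
  have hb : @BorelSpace Z t _ := by
    refine @BorelSpace.mk Z t _ ?_
    rw [borel_eq_borel_of_le htp hpZ ht]
    exact hbZ
  let := @TopologicalSpace.upgradeIsCompletelyMetrizable Z t inferInstance
  have : SecondCountableTopology Z := htp.toSecondCountableTopology
  exact isSigmaInjective_univ_of_continuous hft hcount

/-- A countable Borel equivalence relation is enumerated by countably many measurable maps. -/
theorem IsCountableBorelRel.exists_measurable_enumeration {X : Type*} [MeasurableSpace X]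
    [StandardBorelSpace X] {R : Setoid X} (hR : IsCountableBorelRel R) :
    ∃ g : ℕ → X → X, (∀ n, Measurable (g n)) ∧ ∀ x y, R x y ↔ ∃ n, g n x = y := by
  classical
  let P : Set (X × X) := {p | R p.1 p.2}
  have hP : MeasurableSet P := hR.borel
  have := hP.standardBorel
  obtain ⟨B, hB, hBU⟩ := isSigmaInjective_univ_of_measurable (f := fun p : P => (p : X × X).1)
    (measurable_fst.comp measurable_subtype_coe) fun x => by
      refine MapsTo.countable_of_injOn (f := fun p : P => (p : X × X).2) (t := {y | R x y}) ?_
        ?_ (hR.countable_class x)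
      · rintro ⟨⟨a, b⟩, hab⟩ rfl
        exact hab
      · rintro ⟨⟨a, b⟩, hab⟩ rfl ⟨⟨a', b'⟩, hab'⟩ h h'
        simp_all
  let Q : ℕ → Set (X × X) := fun n => Subtype.val '' B n
  have hQ : ∀ n, MeasurableSet (Q n) := fun n => hP.subtype_image (hB n).1
  have hQinj : ∀ n, InjOn Prod.fst (Q n) := by
    rintro n _ ⟨p, hp, rfl⟩ _ ⟨q, hq, rfl⟩ h
    rw [(hB n).2 hp hq h]
  have hQR : ∀ n x y, (x, y) ∈ Q n → R x y := by
    rintro n x y ⟨p, -, h⟩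
    have := p.2
    rw [h] at this
    exact this
  -- The default `x` keeps the graph of `g n` inside `R`.
  let g : ℕ → X → X := fun n x => if h : ∃ y, (x, y) ∈ Q n then h.choose else x
  have hg : ∀ n x y, (x, y) ∈ Q n → g n x = y := by
    intro n x y hxy
    have h : ∃ y, (x, y) ∈ Q n := ⟨y, hxy⟩
    have := hQinj n h.choose_spec hxy rfl
    simp only [g, h, dif_pos]
    exact congrArg Prod.snd this
  have hg' : ∀ n x, (¬ ∃ y, (x, y) ∈ Q n) → g n x = x :=
    fun n x h => by simp only [g, h, dif_neg, not_false_iff]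
  refine ⟨g, fun n s hs => ?_, fun x y => ⟨fun hxy => ?_, ?_⟩⟩
  · have h1 : ∀ t : Set (X × X), MeasurableSet t → MeasurableSet (Prod.fst '' (Q n ∩ t)) :=
      fun t ht => ((hQ n).inter ht).image_of_measurable_injOn measurable_fst
        ((hQinj n).mono inter_subset_left)
    have : g n ⁻¹' s = Prod.fst '' (Q n ∩ Prod.snd ⁻¹' s) ∪
        ((Prod.fst '' (Q n ∩ univ))ᶜ ∩ s) := by
      ext x
      by_cases h : ∃ y, (x, y) ∈ Q n
      · obtain ⟨y, hy⟩ := h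
        constructor
        · intro hx
          refine Or.inl ⟨(x, y), ⟨hy, ?_⟩, rfl⟩
          rw [mem_preimage, hg n x y hy] at hx
          exact hx
        · rintro (⟨⟨x', y'⟩, ⟨h1, h2⟩, rfl⟩ | ⟨h1, -⟩)
          · rw [mem_preimage, hg n _ _ h1]
            exact h2
          · exact absurd ⟨(x, y), ⟨hy, trivial⟩, rfl⟩ h1
      · rw [mem_preimage, hg' n x h]
        constructor
        · refine fun hx => Or.inr ⟨?_, hx⟩
          rintro ⟨⟨x', y'⟩, ⟨h1, -⟩, rfl⟩
          exact h ⟨y', h1⟩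
        · rintro (⟨⟨x', y'⟩, ⟨h1, h2⟩, rfl⟩ | ⟨-, hx⟩)
          · exact absurd ⟨y', h1⟩ h
          · exact hx
    rw [this]
    exact (h1 _ (measurable_snd hs)).union ((h1 _ MeasurableSet.univ).compl.inter hs)
  · have : (⟨(x, y), hxy⟩ : P) ∈ ⋃ n, B n := hBU ▸ mem_univ _
    obtain ⟨n, hn⟩ := mem_iUnion.1 this
    exact ⟨n, hg n x y ⟨_, hn, rfl⟩⟩
  · rintro ⟨n, rfl⟩
    by_cases h : ∃ y, (x, y) ∈ Q n
    · obtain ⟨y, hy⟩ := h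
      rw [hg n x y hy]
      exact hQR n x y hy
    · rw [hg' n x h]

end LusinNovikov


/-! ### Contracting connected pieces of a tree -/

section Contraction

/-- Contracting the fibers of `r`, each of which is connected, turns a tree into a tree. -/
theorem SimpleGraph.IsTree.of_contraction {V W : Type*} {G : SimpleGraph V} (hG : G.IsTree)
    {r : V → W} (hr : Function.Surjective r) {F : SimpleGraph V}
    (hF : ∀ u v, F.Adj u v → G.Adj u v ∧ r u = r v)
    (hconn : ∀ u v, r u = r v → F.Reachable u v) {T : SimpleGraph W}
    (hT : ∀ a b, T.Adj a b ↔ a ≠ b ∧ ∃ u v, G.Adj u v ∧ r u = a ∧ r v = b) :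
    T.IsTree := by
  have hmap : ∀ {u v}, G.Walk u v → T.Reachable (r u) (r v) := by
    intro u v p
    induction p with
    | nil => exact SimpleGraph.Reachable.refl _
    | @cons u v w h p ih =>
      by_cases huv : r u = r v
      · rwa [huv]
      · exact ((hT _ _).2 ⟨huv, u, v, h, rfl, rfl⟩).reachable.trans ih
  have : Nonempty W := hG.connected.nonempty.map r
  refine ⟨⟨fun a b => ?_⟩, ?_⟩
  · obtain ⟨u, rfl⟩ := hr a
    obtain ⟨v, rfl⟩ := hr b
    obtain ⟨p⟩ := hG.connected u v
    exact hmap p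
  · rw [SimpleGraph.isAcyclic_iff_forall_adj_isBridge]
    intro a b hab
    obtain ⟨hne, u, v, huv, rfl, rfl⟩ := (hT a b).1 hab
    have hbridge := SimpleGraph.isAcyclic_iff_forall_adj_isBridge.1 hG.isAcyclic huv
    rw [SimpleGraph.isBridge_iff] at hbridge ⊢
    rintro ⟨p⟩
    -- The deleted edge joins different fibers, so the fibers stay connected. A walk of `T` avoiding
    -- the contracted edge therefore lifts to a walk of `G` avoiding `s(u, v)`, which is a bridge.
    have hfib : ∀ x y, r x = r y → (G.deleteEdges {s(u, v)}).Reachable x y := by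
      intro x y hxy
      refine (hconn x y hxy).mono fun c d hcd => ?_
      rw [SimpleGraph.deleteEdges_adj]
      refine ⟨(hF c d hcd).1, fun h => ?_⟩
      have hcd' := (hF c d hcd).2
      rcases Sym2.eq_iff.1 (mem_singleton_iff.1 h) with ⟨rfl, rfl⟩ | ⟨rfl, rfl⟩
      · exact hne hcd'
      · exact hne hcd'.symm
    have hlift : ∀ {a b}, (T.deleteEdges {s(r u, r v)}).Walk a b → ∀ x y, r x = a → r y = b →
        (G.deleteEdges {s(u, v)}).Reachable x y := by
      intro a b p
      induction p with
      | nil => exact fun x y hx hy => hfib x y (hx.trans hy.symm)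
      | @cons a c b h p ih =>
        intro x y hx hy
        rw [SimpleGraph.deleteEdges_adj] at h
        obtain ⟨-, c', d', hcd, rfl, rfl⟩ := (hT _ _).1 h.1
        refine (hfib x c' hx).trans (SimpleGraph.Reachable.trans ?_ (ih d' y rfl hy))
        refine SimpleGraph.Adj.reachable ?_
        rw [SimpleGraph.deleteEdges_adj]
        refine ⟨hcd, fun he => h.2 ?_⟩
        have := congrArg (Sym2.map r) (mem_singleton_iff.1 he)
        simpa using this
    exact hbridge (hlift p u v rfl rfl)

end Contraction

/-! ### The retraction onto a class -/

section Retraction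

variable {X Y : Type*}

/-- `u` can be joined to a point of the image under `i` of the `S`-class of `x` by a walk of
length at most `n`. -/
def WithinDist (G : SimpleGraph X) (S : Setoid Y) (i : Y → X) : ℕ → Y → X → Prop
  | 0, x, u => ∃ c, S x c ∧ i c = u
  | n + 1, x, u => WithinDist G S i n x u ∨ ∃ v, G.Adj u v ∧ WithinDist G S i n x v

/-- `v` is a neighbor of `u` which is strictly closer than `u` to the `S`-class of `x`. -/
def IsCloser (G : SimpleGraph X) (S : Setoid Y) (i : Y → X) (x : Y) (u v : X) : Prop :=
  G.Adj u v ∧ ∃ n, WithinDist G S i n x v ∧ ¬ WithinDist G S i n x u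

open Classical in
/-- One step from `u` towards the `S`-class of `x`: move to the first of the points `g n u` which is
closer to the class, and stay if there is none. -/
noncomputable def stepToward (G : SimpleGraph X) (S : Setoid Y) (i : Y → X) (g : ℕ → X → X)
    (x : Y) (u : X) : X :=
  if h : ∃ n, IsCloser G S i x u (g n u) then g (Nat.find h) u else u

/-- Walking from `u` towards the `S`-class of `x` leads to the point `a` of this class. -/
def RetractsTo (G : SimpleGraph X) (S : Setoid Y) (i : Y → X) (g : ℕ → X → X)
    (x : Y) (u : X) (a : Y) : Prop :=
  S x a ∧ ∃ k, (stepToward G S i g x)^[k] u = i a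

variable {G : SimpleGraph X} {S : Setoid Y} {i : Y → X} {g : ℕ → X → X}

theorem WithinDist.mono {m n : ℕ} (hmn : m ≤ n) {x : Y} {u : X} (h : WithinDist G S i m x u) :
    WithinDist G S i n x u := by
  induction n, hmn using Nat.le_induction with
  | base => exact h
  | succ n _ ih => exact Or.inl ih

theorem withinDist_congr {x x' : Y} (hx : S x x') (n : ℕ) :
    WithinDist G S i n x = WithinDist G S i n x' := by
  induction n with
  | zero =>
    funext u
    refine propext (exists_congr fun c => and_congr_left fun _ => ?_)
    exact ⟨fun h => S.trans (S.symm hx) h, fun h => S.trans hx h⟩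
  | succ n ih => funext u; simp only [WithinDist, ih]

theorem stepToward_congr {x x' : Y} (hx : S x x') :
    stepToward G S i g x = stepToward G S i g x' := by
  have : IsCloser G S i x = IsCloser G S i x' := by
    funext u v
    simp only [IsCloser, withinDist_congr hx]
  funext u
  unfold stepToward
  rw [this]

theorem retractsTo_congr {x x' : Y} (hx : S x x') :
    RetractsTo G S i g x = RetractsTo G S i g x' := by
  funext u a
  simp only [RetractsTo, stepToward_congr hx]
  refine propext (and_congr_left fun _ => ?_)
  exact ⟨fun h => S.trans (S.symm hx) h, fun h => S.trans hx h⟩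

theorem stepToward_eq_or_adj (x : Y) (u : X) :
    stepToward G S i g x u = u ∨ G.Adj u (stepToward G S i g x u) := by
  classical
  by_cases h : ∃ n, IsCloser G S i x u (g n u)
  · right
    simp only [stepToward, dif_pos h]
    exact (Nat.find_spec h).1
  · left
    simp only [stepToward, dif_neg h]

theorem stepToward_of_mem {x a : Y} (ha : S x a) : stepToward G S i g x (i a) = i a := by
  refine dif_neg ?_
  rintro ⟨n, -, m, -, hm⟩
  exact hm (WithinDist.mono (Nat.zero_le m) ⟨a, ha, rfl⟩)

theorem iterate_stepToward_of_mem {x a : Y} (ha : S x a) (k : ℕ) :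
    (stepToward G S i g x)^[k] (i a) = i a :=
  Function.iterate_fixed (stepToward_of_mem ha) k

theorem retractsTo_self {x a : Y} (ha : S x a) : RetractsTo G S i g x (i a) a :=
  ⟨ha, 0, rfl⟩

/-- Points of the class are fixed by the step, so both walks can be prolonged to `k + l` steps
without moving their endpoints. -/
theorem RetractsTo.unique (hi : Function.Injective i) {x a b : Y} {u : X}
    (ha : RetractsTo G S i g x u a) (hb : RetractsTo G S i g x u b) : a = b := by
  obtain ⟨ha, k, hk⟩ := ha
  obtain ⟨hb, l, hl⟩ := hb
  apply hi
  rw [← iterate_stepToward_of_mem (G := G) (i := i) (g := g) ha l, ← hk,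
    ← Function.iterate_add_apply, add_comm, Function.iterate_add_apply, hl,
    iterate_stepToward_of_mem hb k]

theorem retractsTo_stepToward {x a : Y} {u : X} (h : RetractsTo G S i g x u a) :
    RetractsTo G S i g x (stepToward G S i g x u) a := by
  obtain ⟨ha, k, hk⟩ := h
  refine ⟨ha, k, ?_⟩
  rw [← Function.iterate_succ_apply, Function.iterate_succ_apply', hk, stepToward_of_mem ha]

theorem WithinDist.exists_retractsTo (hg : ∀ u v, G.Adj u v → ∃ n, g n u = v) {x : Y} :
    ∀ (n : ℕ) {u : X}, WithinDist G S i n x u → ∃ a, RetractsTo G S i g x u a := by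
  classical
  intro n
  induction n using Nat.strong_induction_on with
  | _ n ih =>
    intro u hu
    by_cases h0 : WithinDist G S i 0 x u
    · obtain ⟨c, hc, rfl⟩ := h0
      exact ⟨c, retractsTo_self hc⟩
    have hex : ∃ m, WithinDist G S i m x u := ⟨n, hu⟩
    have hcl : ∃ m, IsCloser G S i x u (g m u) := by
      obtain ⟨m, hm⟩ : ∃ m, Nat.find hex = m + 1 := by
        refine Nat.exists_eq_succ_of_ne_zero fun h => h0 ?_
        have := Nat.find_spec hex
        rwa [h] at this
      have hmu : ¬ WithinDist G S i m x u := Nat.find_min hex (by omega)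
      have hsucc : WithinDist G S i (m + 1) x u := hm ▸ Nat.find_spec hex
      obtain ⟨v, huv, hv⟩ := hsucc.resolve_left hmu
      obtain ⟨l, rfl⟩ := hg u v huv
      exact ⟨l, huv, m, hv, hmu⟩
    obtain ⟨-, m, hm, hmu⟩ := Nat.find_spec hcl
    -- `WithinDist` is monotone in `n`; it fails for `u` at `m` and holds at `n`.
    have hmn : m < n := by
      by_contra hle
      exact hmu (hu.mono (not_lt.1 hle))
    obtain ⟨a, ha, k, hk⟩ := ih m hmn hm
    refine ⟨a, ha, k + 1, ?_⟩
    rw [Function.iterate_succ_apply, stepToward, dif_pos hcl, hk]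

theorem exists_withinDist_of_walk {x a : Y} (ha : S x a) {u v : X} (p : G.Walk u v)
    (hv : v = i a) : ∃ n, WithinDist G S i n x u := by
  induction p with
  | nil => exact ⟨0, a, ha, hv.symm⟩
  | cons h p ih =>
    obtain ⟨n, hn⟩ := ih hv
    exact ⟨n + 1, Or.inr ⟨_, h, hn⟩⟩

end Retraction

/-! ### Borel measurability of the retraction -/

section Measurability

variable {X Y : Type*} [MeasurableSpace X] [MeasurableSpace Y] [StandardBorelSpace X]
  [StandardBorelSpace Y] {G : SimpleGraph X} {S : Setoid Y} {i : Y → X} {g : ℕ → X → X}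

theorem measurableSet_withinDist (hG : MeasurableSet {p : X × X | G.Adj p.1 p.2})
    (hS : IsBorelRel S) (hi : Measurable i) (hinj : Function.Injective i)
    (hgm : ∀ n, Measurable (g n)) (hg : ∀ u v, G.Adj u v → ∃ n, g n u = v) (n : ℕ) :
    MeasurableSet {p : Y × X | WithinDist G S i n p.1 p.2} := by
  induction n with
  | zero =>
    have : {p : Y × X | WithinDist G S i 0 p.1 p.2} =
        (fun q : Y × Y => (q.1, i q.2)) '' {q | S q.1 q.2} := by
      ext ⟨x, u⟩
      constructor
      · rintro ⟨c, hc, rfl⟩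
        exact ⟨(x, c), hc, rfl⟩
      · rintro ⟨⟨x', c⟩, hc, h⟩
        cases h
        exact ⟨c, hc, rfl⟩
    rw [this]
    refine MeasurableSet.image_of_measurable_injOn hS
      (measurable_fst.prodMk (hi.comp measurable_snd)) ?_
    rintro ⟨x, c⟩ - ⟨x', c'⟩ - h
    rw [Prod.mk.injEq] at h
    exact Prod.ext h.1 (hinj h.2)
  | succ n ih =>
    have : {p : Y × X | WithinDist G S i (n + 1) p.1 p.2} =
        {p : Y × X | WithinDist G S i n p.1 p.2} ∪ ⋃ m,
          ((fun p : Y × X => (p.2, g m p.2)) ⁻¹' {p : X × X | G.Adj p.1 p.2} ∩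
          (fun p : Y × X => (p.1, g m p.2)) ⁻¹' {p : Y × X | WithinDist G S i n p.1 p.2}) := by
      ext ⟨x, u⟩
      simp only [WithinDist, mem_ofPred_eq, mem_union, mem_iUnion, mem_inter_iff, mem_preimage]
      refine or_congr_right ⟨?_, fun ⟨m, h⟩ => ⟨_, h⟩⟩
      rintro ⟨v, huv, hv⟩
      obtain ⟨m, rfl⟩ := hg u v huv
      exact ⟨m, huv, hv⟩
    rw [this]
    refine ih.union (MeasurableSet.iUnion fun m => MeasurableSet.inter ?_ ?_)
    · exact (measurable_snd.prodMk ((hgm m).comp measurable_snd)) hG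
    · exact (measurable_fst.prodMk ((hgm m).comp measurable_snd)) ih

theorem measurable_stepToward (hG : MeasurableSet {p : X × X | G.Adj p.1 p.2})
    (hS : IsBorelRel S) (hi : Measurable i) (hinj : Function.Injective i)
    (hgm : ∀ n, Measurable (g n)) (hg : ∀ u v, G.Adj u v → ∃ n, g n u = v) :
    Measurable fun p : Y × X => stepToward G S i g p.1 p.2 := by
  classical
  have hD := measurableSet_withinDist hG hS hi hinj hgm hg
  have hcl : ∀ n, MeasurableSet {p : Y × X | IsCloser G S i p.1 p.2 (g n p.2)} := by
    intro n
    have : {p : Y × X | IsCloser G S i p.1 p.2 (g n p.2)} =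
        (fun p : Y × X => (p.2, g n p.2)) ⁻¹' {p : X × X | G.Adj p.1 p.2} ∩ ⋃ m,
          ((fun p : Y × X => (p.1, g n p.2)) ⁻¹' {p : Y × X | WithinDist G S i m p.1 p.2} ∩
            {p : Y × X | WithinDist G S i m p.1 p.2}ᶜ) := by
      ext p
      simp [IsCloser]
    rw [this]
    refine MeasurableSet.inter ((measurable_snd.prodMk ((hgm n).comp measurable_snd)) hG) ?_
    refine MeasurableSet.iUnion fun m => MeasurableSet.inter ?_ (hD m).compl
    exact (measurable_fst.prodMk ((hgm n).comp measurable_snd)) (hD m)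
  have hex : MeasurableSet {p : Y × X | ∃ n, IsCloser G S i p.1 p.2 (g n p.2)} := by
    rw [ofPred_exists]
    exact MeasurableSet.iUnion hcl
  -- The second alternative makes the search total, so that `measurable_find` applies; where a
  -- closer point exists, it does not change the index found.
  have htot : ∀ p : Y × X, ∃ n, IsCloser G S i p.1 p.2 (g n p.2) ∨
      ¬ ∃ n, IsCloser G S i p.1 p.2 (g n p.2) := by
    intro p
    by_cases h : ∃ n, IsCloser G S i p.1 p.2 (g n p.2)
    · exact h.imp fun n hn => Or.inl hn
    · exact ⟨0, Or.inr h⟩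
  have hfind : Measurable fun p : Y × X => Nat.find (htot p) :=
    measurable_find htot fun n => (hcl n).union hex.compl
  have hgfind : Measurable fun p : Y × X => g (Nat.find (htot p)) p.2 := by
    have : Measurable fun q : ℕ × X => g q.1 q.2 := measurable_from_prod_countable_right hgm
    exact this.comp (hfind.prodMk measurable_snd)
  have hite : Measurable fun p : Y × X => if ∃ n, IsCloser G S i p.1 p.2 (g n p.2) then
      g (Nat.find (htot p)) p.2 else p.2 := Measurable.ite hex hgfind measurable_snd
  convert hite using 1
  funext p
  by_cases h : ∃ n, IsCloser G S i p.1 p.2 (g n p.2)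
  · simp only [stepToward, dif_pos h, if_pos h]
    congr 1
    simp [h]
  · simp only [stepToward, dif_neg h, if_neg h]

theorem measurableSet_retractsTo (hG : MeasurableSet {p : X × X | G.Adj p.1 p.2})
    (hS : IsBorelRel S) (hi : Measurable i) (hinj : Function.Injective i)
    (hgm : ∀ n, Measurable (g n)) (hg : ∀ u v, G.Adj u v → ∃ n, g n u = v) :
    MeasurableSet {p : (Y × X) × Y | RetractsTo G S i g p.1.1 p.1.2 p.2} := by
  have hstep := measurable_stepToward hG hS hi hinj hgm hg
  have hit : ∀ k, Measurable fun p : Y × X => (stepToward G S i g p.1)^[k] p.2 := by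
    intro k
    induction k with
    | zero => exact measurable_snd
    | succ k ih =>
      simp only [Function.iterate_succ_apply']
      exact hstep.comp (measurable_fst.prodMk ih)
  have : {p : (Y × X) × Y | RetractsTo G S i g p.1.1 p.1.2 p.2} =
      (fun p : (Y × X) × Y => (p.1.1, p.2)) ⁻¹' {p : Y × Y | S p.1 p.2} ∩ ⋃ k,
        {p : (Y × X) × Y | (stepToward G S i g p.1.1)^[k] p.1.2 = i p.2} := by
    ext p
    simp [RetractsTo]
  rw [this]
  refine MeasurableSet.inter
    ((measurable_fst.comp measurable_fst).prodMk measurable_snd hS) ?_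
  exact MeasurableSet.iUnion fun k =>
    measurableSet_eq_fun ((hit k).comp measurable_fst) (hi.comp measurable_snd)

end Measurability

/-! ### The contracted treeing -/

section Treeing

variable {X Y : Type*}

/-- The graph on `Y` obtained by contracting, for every `S`-class `C`, the ambient tree containing
`i '' C` along the retraction onto `i '' C`. -/
def contractedGraph (G : SimpleGraph X) (S : Setoid Y) (i : Y → X) (g : ℕ → X → X) :
    SimpleGraph Y where
  Adj a b := a ≠ b ∧ S a b ∧ ∃ u v, G.Adj u v ∧ RetractsTo G S i g a u a ∧ RetractsTo G S i g a v b
  symm := ⟨by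
    rintro a b ⟨hne, hab, u, v, huv, hu, hv⟩
    rw [retractsTo_congr hab] at hu hv
    exact ⟨hne.symm, S.symm hab, v, u, huv.symm, hv, hu⟩⟩
  loopless := ⟨fun _ h => h.1 rfl⟩

variable {G : SimpleGraph X} {S : Setoid Y} {i : Y → X} {g : ℕ → X → X} {R : Setoid X}

theorem rel_of_retractsTo (hGR : ∀ u v, G.Adj u v → R u v) {x a : Y} {u : X}
    (h : RetractsTo G S i g x u a) : R u (i a) := by
  obtain ⟨-, k, hk⟩ := h
  induction k generalizing u with
  | zero => exact hk ▸ R.refl u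
  | succ k ih =>
    rw [Function.iterate_succ_apply] at hk
    rcases stepToward_eq_or_adj (G := G) (S := S) (i := i) (g := g) x u with h | h
    · rw [h] at hk
      exact ih hk
    · exact R.trans (hGR _ _ h) (ih hk)

theorem isTree_induce_contractedGraph (hGR : ∀ u v, G.Adj u v → R u v)
    (hinj : Function.Injective i) (hg : ∀ u v, G.Adj u v → ∃ n, g n u = v)
    (hSR : ∀ a b, S a b → R (i a) (i b)) (x : Y)
    (htree : (G.induce {u | R (i x) u}).IsTree) :
    ((contractedGraph G S i g).induce {b | S x b}).IsTree := by
  have hex : ∀ u : {u | R (i x) u}, ∃ a : {b | S x b}, RetractsTo G S i g x u a := by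
    intro u
    obtain ⟨p⟩ := htree.connected u ⟨i x, R.refl _⟩
    obtain ⟨n, hn⟩ := exists_withinDist_of_walk (S := S) (i := i) (S.refl x)
      (p.map (SimpleGraph.Embedding.induce _).toHom) rfl
    obtain ⟨a, ha⟩ := hn.exists_retractsTo hg n
    exact ⟨⟨a, ha.1⟩, ha⟩
  choose r hr using hex
  have hr_eq : ∀ u a, RetractsTo G S i g x u.1 a → (r u : Y) = a :=
    fun u a h => (hr u).unique hinj h
  -- The edges inside the fibers of `r`. Each step of the walk towards the class is one of them,
  -- since it preserves the endpoint.
  let F : SimpleGraph {u | R (i x) u} :=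
    { Adj := fun u v => G.Adj u v ∧ r u = r v
      symm := ⟨fun u v h => ⟨h.1.symm, h.2.symm⟩⟩
      loopless := ⟨fun u h => h.1.ne rfl⟩ }
  have hmem : ∀ a, S x a → R (i x) (i a) := fun a ha => hSR x a ha
  have hreach : ∀ (k : ℕ) (u : {u | R (i x) u}) (a : Y) (ha : S x a),
      (stepToward G S i g x)^[k] u = i a → F.Reachable u ⟨i a, hmem a ha⟩ := by
    intro k
    induction k with
    | zero =>
      intro u a ha hu
      have : u = ⟨i a, hmem a ha⟩ := Subtype.ext hu
      rw [this]
    | succ k ih =>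
      intro u a ha hu
      have hru : RetractsTo G S i g x u a := ⟨ha, k + 1, hu⟩
      rw [Function.iterate_succ_apply] at hu
      rcases stepToward_eq_or_adj (G := G) (S := S) (i := i) (g := g) x u.1 with h | h
      · rw [h] at hu
        exact ih u a ha hu
      · let v : {u | R (i x) u} := ⟨stepToward G S i g x u, R.trans u.2 (hGR _ _ h)⟩
        have huv : F.Adj u v := ⟨h, Subtype.ext (by
          rw [hr_eq u a hru, hr_eq v a (retractsTo_stepToward hru)])⟩
        exact huv.reachable.trans (ih v a ha hu)
  have hreach' : ∀ u, F.Reachable u ⟨i (r u), hmem _ (r u).2⟩ := by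
    intro u
    obtain ⟨ha, k, hk⟩ := hr u
    exact hreach k u (r u) ha hk
  refine htree.of_contraction (r := r) (F := F) ?_ (fun u v h => h) ?_ ?_
  · intro a
    exact ⟨⟨i a, hmem a a.2⟩, Subtype.ext (hr_eq _ a (retractsTo_self a.2))⟩
  · intro u v huv
    have h := hreach' v
    simp only [← huv] at h
    exact (hreach' u).trans h.symm
  · intro a b
    have hxa : S x a := a.2
    rw [SimpleGraph.induce_adj]
    constructor
    · rintro ⟨hne, hab, u, v, huv, hu, hv⟩
      rw [← retractsTo_congr hxa] at hu hv
      have hu' : R (i x) u := R.trans (hmem a hxa) (R.symm (rel_of_retractsTo hGR hu))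
      have hv' : R (i x) v := R.trans hu' (hGR _ _ huv)
      exact ⟨fun h => hne (congrArg Subtype.val h), ⟨u, hu'⟩, ⟨v, hv'⟩, huv,
        Subtype.ext (hr_eq _ _ hu), Subtype.ext (hr_eq _ _ hv)⟩
    · rintro ⟨hne, u, v, huv, rfl, rfl⟩
      refine ⟨fun h => hne (Subtype.ext h), S.trans (S.symm hxa) (r v).2, u, v, huv, ?_, ?_⟩
      · rw [← retractsTo_congr hxa]
        exact hr u
      · rw [← retractsTo_congr hxa]
        exact hr v

/-- The witnesses `u` and `v` lie in the `R`-class of `i a`, so they can be sought among the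
countably many points `g n (i a)` and `g m (g n (i a))`. -/
theorem measurableSet_contractedGraph_adj [MeasurableSpace X] [MeasurableSpace Y]
    [StandardBorelSpace X] [StandardBorelSpace Y]
    (hG : MeasurableSet {p : X × X | G.Adj p.1 p.2}) (hGR : ∀ u v, G.Adj u v → R u v)
    (hS : IsBorelRel S) (hi : Measurable i) (hinj : Function.Injective i)
    (hgm : ∀ n, Measurable (g n)) (hgR : ∀ u v, R u v ↔ ∃ n, g n u = v) :
    MeasurableSet {p : Y × Y | (contractedGraph G S i g).Adj p.1 p.2} := by
  have hg : ∀ u v, G.Adj u v → ∃ n, g n u = v := fun u v h => (hgR u v).1 (hGR u v h)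
  have hret := measurableSet_retractsTo hG hS hi hinj hgm hg
  have : {p : Y × Y | (contractedGraph G S i g).Adj p.1 p.2} =
      {p | p.1 = p.2}ᶜ ∩ ({p | S p.1 p.2} ∩ ⋃ n, ⋃ m,
        ((fun p : Y × Y => (g n (i p.1), g m (g n (i p.1)))) ⁻¹' {p : X × X | G.Adj p.1 p.2} ∩
        ((fun p : Y × Y => ((p.1, g n (i p.1)), p.1)) ⁻¹'
            {p : (Y × X) × Y | RetractsTo G S i g p.1.1 p.1.2 p.2} ∩
          (fun p : Y × Y => ((p.1, g m (g n (i p.1))), p.2)) ⁻¹'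
            {p : (Y × X) × Y | RetractsTo G S i g p.1.1 p.1.2 p.2}))) := by
    ext ⟨a, b⟩
    simp only [mem_inter_iff, mem_compl_iff, mem_iUnion, mem_ofPred_eq, mem_preimage]
    refine and_congr_right fun _ => and_congr_right fun _ => ?_
    constructor
    · rintro ⟨u, v, huv, hu, hv⟩
      obtain ⟨n, rfl⟩ := (hgR (i a) u).1 (R.symm (rel_of_retractsTo hGR hu))
      obtain ⟨m, rfl⟩ := hg _ v huv
      exact ⟨n, m, huv, hu, hv⟩
    · rintro ⟨n, m, h⟩
      exact ⟨_, _, h⟩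
  rw [this]
  refine (measurableSet_eq_fun measurable_fst measurable_snd).compl.inter
    (hS.inter (MeasurableSet.iUnion fun n => MeasurableSet.iUnion fun m => ?_))
  have hn : Measurable fun p : Y × Y => g n (i p.1) := (hgm n).comp (hi.comp measurable_fst)
  have hm : Measurable fun p : Y × Y => g m (g n (i p.1)) := (hgm m).comp hn
  exact (hn.prodMk hm hG).inter (((measurable_fst.prodMk hn).prodMk measurable_fst hret).inter
    ((measurable_fst.prodMk hm).prodMk measurable_snd hret))

/-- A Borel equivalence relation that embeds measurably into a treeable countable Borel equivalence
relation is treeable. -/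
theorem IsTreeable.of_injective [MeasurableSpace X] [StandardBorelSpace X] [MeasurableSpace Y]
    [StandardBorelSpace Y] (hR : IsCountableBorelRel R) (hT : IsTreeable R) (hS : IsBorelRel S)
    (hi : Measurable i) (hinj : Function.Injective i) (hSR : ∀ a b, S a b → R (i a) (i b)) :
    IsTreeable S := by
  obtain ⟨G, hG⟩ := hT
  obtain ⟨g, hgm, hgR⟩ := hR.exists_measurable_enumeration
  refine ⟨contractedGraph G S i g,
    measurableSet_contractedGraph_adj hG.borel hG.adj_rel hS hi hinj hgm hgR,
    fun a b h => h.2.1, fun x => ?_⟩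
  exact isTree_induce_contractedGraph hG.adj_rel hinj
    (fun u v h => (hgR u v).1 (hG.adj_rel u v h)) hSR x (hG.isTree (i x))

end Treeing

/-- Borel subrelations of a treeable countable Borel equivalence relation are treeable: those
defined on all of `X`, and those defined on a Borel subset `A` of `X`. -/
theorem mainTheorem4 {X : Type*} [MeasurableSpace X] [StandardBorelSpace X]
    (R : Setoid X) (hR : IsCountableBorelRel R) (hT : IsTreeable R) :
    (∀ S : Setoid X, IsBorelRel S → (∀ x y : X, S x y → R x y) → IsTreeable S) ∧
    (∀ A : Set X, MeasurableSet A → ∀ S : Setoid A, IsBorelRel S →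
      (∀ x y : A, S x y → R x y) → IsTreeable S) := by
  refine ⟨fun S hS hSR => hT.of_injective hR hS measurable_id Function.injective_id hSR,
    fun A hA S hS hSR => ?_⟩
  have := hA.standardBorel
  exact hT.of_injective hR hS measurable_subtype_coe Subtype.val_injective hSR
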